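/- Let $\mathcal N=\mathcal N(P,E)$ be a matroid or an oriented matroid on a finite ground set $P\sqcup E$ (the elements of $P$ are the ports). Let $\rho$ be the rank function of (the underlying matroid of) $\mathcal N$, and for a matroid $\mathcal M$ let $\rho\mathcal M$ be its rank. For $A\subseteq E$ let $\mathcal N/A|P$ be the (oriented, if $\mathcal N$ is oriented) minor obtained by contracting $A$ and restricting to $P$. Take one commuting variable for each connected (oriented) matroid, and for an (oriented) matroid $\mathcal Q$ let $[\mathcal Q]$ be the product of the variables of its connected components, so $[\emptyset]=1$. Let $K$ be a commutative ring, let $r_e,g_e\in K$ $(e\in E)$ and $u,v\in K$ with $v$ invertible (for instance, $u$, $v$, $r_e$, $g_e$ may be indeterminates, with $v$ inverted). The parametrized ported corank-nullity polynomial is $$R_P(\mathcal N)(u,v)=\sum_{A\subseteq E}[\mathcal N/A|P]\Big(\prod_{e\in A}g_e\Big)\Big(\prod_{e\in E\setminus A}r_e\Big)u^{\rho\mathcal N-\rho(\mathcal N/A|P)-\rho A}\,v^{|A|-\rho A}.$$ Then $$R_P(\mathcal N)(u,v)=\sum_{\mathcal Q}[\mathcal Q]\sum_{F:\ [\mathcal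 N/F|P]=[\mathcal Q]}u^{\rho\mathcal N-\rho\mathcal Q-\rho F}\,v^{-\rho F}\sum_{G\le F}\mu(G,F)\prod_{e\in G}(r_e+g_ev)\prod_{e\in E\setminus G}r_e ,$$ where $\mathcal Q$ ranges over the distinct minors $\mathcal N/A|P$ with $A\subseteq E$, $F$ and $G$ range over the geometric lattice of flats of the restriction $\mathcal N|E$ (ordered by inclusion), and $\mu$ is the Möbius function of this lattice. -/

import Mathlib

/-- Composition `X ∘ Y` of sign vectors. -/
def signComp {α : Type*} (X Y : α → SignType) : α → SignType :=
  fun e => if X e = 0 then Y e else X e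

/-- The separation set `S(X, Y)`: the elements on which `X` and `Y` have opposite nonzero signs. -/
def signSep {α : Type*} (X Y : α → SignType) : Set α :=
  {e | X e ≠ 0 ∧ X e = -Y e}

/-- An oriented matroid on a finite ground set `E`, given by its set of covectors
(sign vectors on `E`, extended by zero outside `E`). -/
@[ext]
structure OrientedMatroid (α : Type*) where
  E : Set α
  finite_E : E.Finite
  covectors : Set (α → SignType)
  support_subset : ∀ X ∈ covectors, ∀ e, X e ≠ 0 → e ∈ E
  zero_mem : (fun _ => 0) ∈ covectors
  neg_mem : ∀ X ∈ covectors, (fun e => -X e) ∈ covectors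
  comp_mem : ∀ X ∈ covectors, ∀ Y ∈ covectors, signComp X Y ∈ covectors
  elim : ∀ X ∈ covectors, ∀ Y ∈ covectors, ∀ e ∈ signSep X Y,
    ∃ Z ∈ covectors, Z e = 0 ∧ ∀ f, f ∉ signSep X Y → Z f = signComp X Y f

namespace OrientedMatroid

variable {α : Type*}

/-- Independence in the underlying matroid: no `e ∈ I` lies in every covector zero set
that contains `I \ {e}`. (The zero sets of covectors are the flats of the underlying matroid.) -/
def IndepSet (O : OrientedMatroid α) (I : Set α) : Prop :=
  I ⊆ O.E ∧ ∀ e ∈ I, ∃ X ∈ O.covectors, X e ≠ 0 ∧ ∀ f ∈ I, f ≠ e → X f = 0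

theorem exists_elim (O : OrientedMatroid α) {X Z : α → SignType} (hX : X ∈ O.covectors)
    (hZ : Z ∈ O.covectors) {x : α} (hXx : X x ≠ 0) :
    ∃ W ∈ O.covectors, W x = 0 ∧ ∀ f, X f = 0 → W f = Z f := by
  by_cases hZx : Z x = 0
  · exact ⟨Z, hZ, hZx, fun _ _ => rfl⟩
  have key : ∃ X' ∈ O.covectors, x ∈ signSep Z X' ∧ ∀ f, X f = 0 → X' f = 0 := by
    by_cases h : Z x = -X x
    · exact ⟨X, hX, ⟨hZx, h⟩, fun _ h => h⟩
    · refine ⟨_, O.neg_mem X hX, ⟨hZx, ?_⟩, fun f hf => by simp [hf]⟩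
      have hsign : ∀ a b : SignType, b ≠ 0 → a ≠ 0 → a ≠ -b → a = - -b := by decide
      exact hsign _ _ hXx hZx h
  obtain ⟨X', hX', hsep, h0⟩ := key
  obtain ⟨W, hW, hWx, hWf⟩ := O.elim Z hZ X' hX' x hsep
  refine ⟨W, hW, hWx, fun f hf => ?_⟩
  have h1 := h0 f hf
  rw [hWf f (fun h => h.1 (by rw [h.2, h1]; rfl))]
  unfold signComp
  split_ifs with h
  · rw [h1, h]
  · rfl

theorem IndepSet.insert {O : OrientedMatroid α} {I : Set α} (hI : O.IndepSet I)
    {X : α → SignType} (hX : X ∈ O.covectors) (hXI : ∀ f ∈ I, X f = 0) {x : α} (hx : X x ≠ 0) :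
    O.IndepSet (insert x I) := by
  refine ⟨Set.insert_subset (O.support_subset X hX x hx) hI.1, ?_⟩
  rintro e (rfl | he)
  · refine ⟨X, hX, hx, ?_⟩
    rintro f (rfl | hf) hne
    · exact absurd rfl hne
    · exact hXI f hf
  · obtain ⟨Z, hZ, hZe, hZI⟩ := hI.2 e he
    obtain ⟨W, hW, hWx, hWf⟩ := O.exists_elim hX hZ hx
    refine ⟨W, hW, by rwa [hWf e (hXI e he)], ?_⟩
    rintro f (rfl | hf) hne
    · exact hWx
    · rw [hWf f (hXI f hf), hZI f hf hne]

/-- The underlying (unoriented) matroid. -/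
def toMatroid (O : OrientedMatroid α) : Matroid α :=
  IndepMatroid.matroid
    { E := O.E
      Indep := O.IndepSet
      indep_empty := ⟨Set.empty_subset _, fun _ h => h.elim⟩
      indep_subset := fun I J hJ hIJ => ⟨hIJ.trans hJ.1, fun e he => by
        obtain ⟨X, hX, hXe, h⟩ := hJ.2 e (hIJ he)
        exact ⟨X, hX, hXe, fun f hf hne => h f (hIJ hf) hne⟩⟩
      indep_aug := by
        intro I B hI hImax hB
        by_contra! hcon
        have hvan : ∀ X ∈ O.covectors, (∀ f ∈ I, X f = 0) → ∀ x ∈ B, X x = 0 := by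
          intro X hX hXI x hxB
          by_cases hxI : x ∈ I
          · exact hXI x hxI
          · by_contra hne
            exact hcon x ⟨hxB, hxI⟩ (hI.insert hX hXI hne)
        obtain ⟨J, hIJ, hJ⟩ := (not_maximal_iff_exists_gt hI).1 hImax
        obtain ⟨y, hyJ, hyI⟩ := Set.exists_of_ssubset hIJ
        obtain ⟨Y, hY, hYy, hYJ⟩ := hJ.2 y hyJ
        have hYB := hvan Y hY
          (fun f hf => hYJ f (hIJ.le hf) (fun h => hyI (h ▸ hf)))
        have hyB := hB.2 (hB.1.insert hY hYB hYy) (Set.subset_insert y B)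
          (Set.mem_insert y B)
        exact hYy (hYB y hyB)
      indep_maximal := by
        intro X hX I hI hIX
        have hfin : {J | O.IndepSet J ∧ J ⊆ X}.Finite :=
          O.finite_E.finite_subsets.subset (fun J hJ => hJ.2.trans hX)
        obtain ⟨J, hIJ, hJ⟩ := hfin.exists_le_maximal (show I ∈ _ from ⟨hI, hIX⟩)
        exact ⟨J, hIJ, hJ⟩
      subset_ground := fun I hI => hI.1 }

/-- Contraction `O / A`. -/
def contract (O : OrientedMatroid α) (A : Set α) : OrientedMatroid α where
  E := O.E \ A
  finite_E := O.finite_E.subset Set.sdiff_subset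
  covectors := {X | X ∈ O.covectors ∧ ∀ e ∈ A, X e = 0}
  support_subset := fun X hX e he => ⟨O.support_subset X hX.1 e he, fun h => he (hX.2 e h)⟩
  zero_mem := ⟨O.zero_mem, fun _ _ => rfl⟩
  neg_mem := fun X hX => ⟨O.neg_mem X hX.1, fun e he => by simp [hX.2 e he]⟩
  comp_mem := fun X hX Y hY =>
    ⟨O.comp_mem X hX.1 Y hY.1, fun e he => by simp [signComp, hX.2 e he, hY.2 e he]⟩
  elim := by
    intro X hX Y hY e he
    obtain ⟨Z, hZ, hZe, hZf⟩ := O.elim X hX.1 Y hY.1 e he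
    refine ⟨Z, ⟨hZ, fun f hf => ?_⟩, hZe, hZf⟩
    rw [hZf f (fun h => h.1 (hX.2 f hf))]
    simp [signComp, hX.2 f hf, hY.2 f hf]

open Classical in
/-- Restriction `O | R` to the elements of `R` in the ground set (deletion of all others). -/
noncomputable def restrict (O : OrientedMatroid α) (R : Set α) : OrientedMatroid α where
  E := O.E ∩ R
  finite_E := O.finite_E.subset Set.inter_subset_left
  covectors := {X | ∃ Y ∈ O.covectors, X = fun e => if e ∈ R then Y e else 0}
  support_subset := by
    rintro _ ⟨Y, hY, rfl⟩ e he
    by_cases h : e ∈ R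
    · exact ⟨O.support_subset Y hY e (by simpa [h] using he), h⟩
    · simp [h] at he
  zero_mem := ⟨_, O.zero_mem, by simp⟩
  neg_mem := by
    rintro _ ⟨Y, hY, rfl⟩
    refine ⟨_, O.neg_mem Y hY, funext fun e => ?_⟩
    by_cases h : e ∈ R <;> simp [h]
  comp_mem := by
    rintro _ ⟨X, hX, rfl⟩ _ ⟨Y, hY, rfl⟩
    refine ⟨_, O.comp_mem X hX Y hY, funext fun e => ?_⟩
    by_cases h : e ∈ R <;> simp [signComp, h]
  elim := by
    rintro _ ⟨X, hX, rfl⟩ _ ⟨Y, hY, rfl⟩ e he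
    have heR : e ∈ R := by
      by_contra h
      exact he.1 (by simp [h])
    obtain ⟨Z, hZ, hZe, hZf⟩ := O.elim X hX Y hY e (by simpa [signSep, heR] using he)
    refine ⟨_, ⟨Z, hZ, rfl⟩, by simp [hZe], fun f hf => ?_⟩
    by_cases h : f ∈ R
    · have := hZf f (by simpa [signSep, h] using hf)
      simp [h, this, signComp]
    · simp [h, signComp]

theorem toMatroid_restrict (O : OrientedMatroid α) {R : Set α} (hR : R ⊆ O.E) :
    (O.restrict R).toMatroid = O.toMatroid.restrict R := by
  classical
  refine Matroid.ext_indep (Set.inter_eq_right.2 hR) fun I _ => ?_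
  change (O.restrict R).IndepSet I ↔ O.IndepSet I ∧ I ⊆ R
  constructor
  · rintro ⟨h1, h2⟩
    have hIR : I ⊆ R := fun e he => (h1 he).2
    refine ⟨⟨fun e he => (h1 he).1, fun e he => ?_⟩, hIR⟩
    obtain ⟨_, ⟨Y, hY, rfl⟩, hYe, hYI⟩ := h2 e he
    refine ⟨Y, hY, by simpa [hIR he] using hYe, fun f hf hne => ?_⟩
    simpa [hIR hf] using hYI f hf hne
  · rintro ⟨⟨h1, h2⟩, hIR⟩
    refine ⟨fun e he => ⟨h1 he, hIR he⟩, fun e he => ?_⟩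
    obtain ⟨Y, hY, hYe, hYI⟩ := h2 e he
    refine ⟨_, ⟨Y, hY, rfl⟩, by simpa [hIR he] using hYe, fun f hf hne => ?_⟩
    simpa [hIR hf] using hYI f hf hne

theorem toMatroid_contract (O : OrientedMatroid α) {A : Set α} (hA : A ⊆ O.E) :
    (O.contract A).toMatroid = O.toMatroid.contract A := by
  refine Matroid.ext_indep rfl fun I hIE => ?_
  obtain ⟨J, hJ⟩ := O.toMatroid.exists_isBasis A hA
  rw [hJ.contract_indep_iff]
  have hI : I ⊆ O.E \ A := hIE
  change (O.contract A).IndepSet I ↔ O.IndepSet (I ∪ J) ∧ Disjoint A I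
  constructor
  · rintro ⟨-, h2⟩
    refine ⟨?_, Set.disjoint_left.2 fun e he he' => (hI he').2 he⟩
    have hfin : I.Finite := O.finite_E.subset (hI.trans Set.sdiff_subset)
    refine hfin.induction_on_subset (motive := fun S _ => O.IndepSet (S ∪ J)) I ?_ ?_
    · rw [Set.empty_union]
      exact hJ.indep
    · intro a S ha hS haS hind
      obtain ⟨X, hX, hXa, hXI⟩ := h2 a ha
      rw [Set.insert_union]
      refine hind.insert hX.1 ?_ hXa
      rintro f (hf | hf)
      · exact hXI f (hS hf) (fun h => haS (h ▸ hf))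
      · exact hX.2 f (hJ.subset hf)
  · rintro ⟨h1, hdisj⟩
    refine ⟨hI, fun e he => ?_⟩
    obtain ⟨X, hX, hXe, hXI⟩ := h1.2 e (Or.inl he)
    have heA : e ∉ A := (hI he).2
    have hXJ : ∀ f ∈ J, X f = 0 := fun f hf =>
      hXI f (Or.inr hf) (fun h => heA (h ▸ hJ.subset hf))
    refine ⟨X, ⟨hX, fun a ha => ?_⟩, hXe, fun f hf hne => hXI f (Or.inl hf) hne⟩
    by_contra hne
    have hJI : O.IndepSet J := hJ.indep
    have haJ : a ∈ J := hJ.mem_of_insert_indep ha (hJI.insert hX hXJ hne)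
    exact hne (hXJ a haJ)

end OrientedMatroid

/-- The connected components of a matroid: the minimal nonempty sets of elements that every
circuit is contained in or disjoint from. -/
def Matroid.componentSet {α : Type*} (M : Matroid α) : Set (Set α) :=
  {K | Minimal (fun S : Set α => S.Nonempty ∧ S ⊆ M.E ∧
    ∀ C, M.IsCircuit C → C ⊆ S ∨ Disjoint C S) K}

/-- An unoriented or oriented matroid. -/
inductive AnyMatroid (α : Type*) where
  | unoriented (M : Matroid α)
  | oriented (O : OrientedMatroid α)

namespace AnyMatroid

variable {α : Type*}

/-- The underlying unoriented matroid. -/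
def underlying : AnyMatroid α → Matroid α
  | unoriented M => M
  | oriented O => O.toMatroid

/-- Contraction of `A`, oriented if the given object is oriented. -/
def contract : AnyMatroid α → Set α → AnyMatroid α
  | unoriented M, A => unoriented (M.contract A)
  | oriented O, A => oriented (O.contract A)

/-- Restriction to a subset `R` of the ground set, oriented if the given object is oriented. -/
noncomputable def restrict : AnyMatroid α → Set α → AnyMatroid α
  | unoriented M, R => unoriented (M.restrict R)
  | oriented O, R => oriented (O.restrict R)

/-- The minor `N / A | P`. -/
noncomputable def portMinor (N : AnyMatroid α) (A P : Finset α) : AnyMatroid α :=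
  (N.contract (A : Set α)).restrict (P : Set α)

/-- The rank of `N`. -/
noncomputable def rank (N : AnyMatroid α) : ℕ := N.underlying.eRank.toNat

/-- The rank in `N` of a set of elements. -/
noncomputable def rk (N : AnyMatroid α) (A : Finset α) : ℕ := (N.underlying.eRk (A : Set α)).toNat

theorem underlying_portMinor (N : AnyMatroid α) {P A : Finset α} (hPA : Disjoint P A)
    (hP : (P : Set α) ⊆ N.underlying.E) (hA : (A : Set α) ⊆ N.underlying.E) :
    (N.portMinor A P).underlying =
      (N.underlying.contract (A : Set α)).restrict (P : Set α) := by
  cases N with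
  | unoriented M => rfl
  | oriented O =>
    have hP' : (P : Set α) ⊆ (O.contract (A : Set α)).E := fun e he =>
      ⟨hP he, fun h => Finset.disjoint_left.1 hPA he h⟩
    change ((O.contract (A : Set α)).restrict (P : Set α)).toMatroid = _
    rw [OrientedMatroid.toMatroid_restrict _ hP', OrientedMatroid.toMatroid_contract _ hA]
    rfl

/-- The exponents of `u` in the corank-nullity polynomial are not negative. -/
theorem rank_portMinor_add_rk_le (N : AnyMatroid α) {P A : Finset α} (hPA : Disjoint P A)
    (hP : (P : Set α) ⊆ N.underlying.E) (hA : (A : Set α) ⊆ N.underlying.E)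
    (hfin : N.underlying.E.Finite) : (N.portMinor A P).rank + N.rk A ≤ N.rank := by
  obtain ⟨J, hJ⟩ := N.underlying.exists_isBasis (A : Set α) hA
  obtain ⟨I, hI⟩ := (N.portMinor A P).underlying.exists_isBase
  have hind := hI.indep
  rw [underlying_portMinor N hPA hP hA, Matroid.restrict_indep_iff, hJ.contract_indep_iff] at hind
  obtain ⟨⟨h1, h2⟩, -⟩ := hind
  have hIJ : Disjoint I J := (h2.mono_left hJ.subset).symm
  have hle : (N.portMinor A P).underlying.eRank + N.underlying.eRk (A : Set α)
      ≤ N.underlying.eRank := by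
    rw [← hI.encard_eq_eRank, ← hJ.encard_eq_eRk, ← Set.encard_union_eq hIJ]
    exact h1.encard_le_eRank
  have htop : N.underlying.eRank ≠ ⊤ :=
    ne_top_of_le_ne_top hfin.encard_lt_top.ne N.underlying.eRank_le_encard_ground
  have h3 := ne_top_of_le_ne_top htop (le_self_add.trans hle)
  have h4 := ne_top_of_le_ne_top htop (le_add_self.trans hle)
  have := ENat.toNat_le_toNat hle htop
  rwa [ENat.toNat_add h3 h4] at this

/-- The exponents of `v` in the corank-nullity polynomial are not negative. -/
theorem rk_le_card (N : AnyMatroid α) (A : Finset α) : N.rk A ≤ A.card := by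
  have h := ENat.toNat_le_toNat (N.underlying.eRk_le_encard (A : Set α)) (by simp)
  simpa [rk] using h

/-- The monomial `[Q]`: there is one variable for each (connected, unoriented or oriented) matroid,
and `[Q]` is the product of the variables of the connected components of `Q`.
(It is used only for `Q` with finite ground set.) -/
noncomputable def bracket (K : Type*) [CommRing K] (Q : AnyMatroid α) :
    MvPolynomial (AnyMatroid α) K :=
  ∏ᶠ S ∈ Q.underlying.componentSet, MvPolynomial.X (Q.restrict S)

open Classical in
/-- The parametrized ported corank-nullity polynomial `R_P(N)(u, v)` of `N = N(P, E)`, a polynomial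
in the variables of connected matroids. The exponents are differences of natural numbers
and are not negative (`rank_portMinor_add_rk_le`, `rk_le_card`). -/
noncomputable def corankNullity {K : Type*} [CommRing K] (N : AnyMatroid α) (P E : Finset α)
    (r g : α → K) (u v : K) : MvPolynomial (AnyMatroid α) K :=
  ∑ A ∈ E.powerset, (N.portMinor A P).bracket K *
    MvPolynomial.C ((∏ e ∈ A, g e) * (∏ e ∈ E \ A, r e) *
      u ^ (N.rank - (N.portMinor A P).rank - N.rk A) * v ^ (A.card - N.rk A))

open Classical in
/-- The distinct minors `N / A | P` with `A ⊆ E`. -/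
noncomputable def portMinors (N : AnyMatroid α) (P E : Finset α) : Finset (AnyMatroid α) :=
  E.powerset.image (fun A => N.portMinor A P)

open Classical in
/-- The flats of `N | E`. Ordered by inclusion they form the geometric lattice of flats in `E`. -/
noncomputable def flats (N : AnyMatroid α) (E : Finset α) : Finset (Finset α) :=
  {F ∈ E.powerset | (N.underlying.restrict (E : Set α)).IsFlat (F : Set α)}

open Classical in
/-- The Möbius function of the lattice of flats of `N | E`. -/
noncomputable def flatMu (N : AnyMatroid α) (E : Finset α) (G F : N.flats E) : ℤ :=
  letI : LocallyFiniteOrder (N.flats E) := Fintype.toLocallyFiniteOrder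
  IncidenceAlgebra.mu ℤ G F

end AnyMatroid

/-! Group the subsets A of E by their closure F in N|E. Contracting A or F leaves the same minor on
P, and A and F have the same rank. So the monomial, the power of u and the factor v^(-ρA) depend on
F alone, and only the weight v^|A| ∏_A g ∏_(E∖A) r has to be summed over the A with closure F. Over
all A ⊆ G, for a flat G, this weight sums to ∏_G (r + gv) ∏_(E∖G) r; Möbius inversion in the lattice
of flats isolates the sets with closure exactly F (`sum_flatClosure_eq`,
`corankNullity_eq_sum_flats`).

It remains to collect flats by minor. The formula selects F by equality of monomials while Q runs
over distinct minors, so a flat would be counted twice if two minors shared a monomial.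
`portMinor_eq_of_bracket_eq` excludes this: the variables are labelled matroids, so the monomial
reveals the components and the restrictions to them. These determine a matroid because each circuit
lies in one component. In the oriented case covectors are glued from their parts on the components,
which requires that the part of a covector in a separator is a covector
(`indicator_mem_of_separator`). -/

namespace OrientedMatroid

/-! ### Covectors, closure and separators in oriented matroids. -/

variable {α : Type*}

theorem notMem_closure_iff (O : OrientedMatroid α) {A : Set α} (hA : A ⊆ O.E) {e : α}
    (he : e ∈ O.E) :
    e ∉ O.toMatroid.closure A ↔ ∃ X ∈ O.covectors, X e ≠ 0 ∧ ∀ f ∈ A, X f = 0 := by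
  obtain ⟨I, hI⟩ := O.toMatroid.exists_isBasis A hA
  have hI_ind : O.IndepSet I := hI.indep
  rw [← hI.closure_eq_closure, hI.indep.mem_closure_iff']
  constructor
  · intro h
    push Not at h
    obtain ⟨h1, h2⟩ := h he
    have h1' : O.IndepSet (insert e I) := h1
    obtain ⟨X, hX, hXe, hXI⟩ := h1'.2 e (Set.mem_insert e I)
    have hXI' : ∀ f ∈ I, X f = 0 := fun f hf =>
      hXI f (Set.mem_insert_of_mem e hf) (fun h => h2 (h ▸ hf))
    refine ⟨X, hX, hXe, fun f hf => ?_⟩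
    by_contra hne
    exact hne (hXI' f (hI.mem_of_insert_indep hf (hI_ind.insert hX hXI' hne)))
  · rintro ⟨X, hX, hXe, hXA⟩ ⟨-, h⟩
    exact hXe (hXA e (hI.subset
      (h (hI_ind.insert hX (fun f hf => hXA f (hI.subset hf)) hXe))))

/-- Composition takes the union of supports and keeps common zeros, so covectors for single elements
combine into one. -/
theorem exists_covector_ne_zero_on (O : OrientedMatroid α) {T Z : Set α} (hT : T.Finite)
    (h : ∀ x ∈ T, ∃ Y ∈ O.covectors, Y x ≠ 0 ∧ ∀ f ∈ Z, Y f = 0) :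
    ∃ Y ∈ O.covectors, (∀ x ∈ T, Y x ≠ 0) ∧ ∀ f ∈ Z, Y f = 0 := by
  induction T, hT using Set.Finite.induction_on with
  | empty => exact ⟨_, O.zero_mem, by simp, fun _ _ => rfl⟩
  | @insert a T ha hT ih =>
    obtain ⟨Y, hY, hYT, hYZ⟩ := ih (fun x hx => h x (Set.mem_insert_of_mem a hx))
    obtain ⟨W, hW, hWa, hWZ⟩ := h a (Set.mem_insert a T)
    refine ⟨signComp Y W, O.comp_mem Y hY W hW, ?_, fun f hf => by
      simp [signComp, hYZ f hf, hWZ f hf]⟩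
    rintro x (rfl | hx)
    · unfold signComp
      split_ifs with h0
      · exact hWa
      · exact h0
    · simp [signComp, hYT x hx]

/-- If `X` and `Y` have the same zeros in `S`, and `Y` vanishes outside `S`, then the part of `X`
in `S` is a covector as soon as this holds for all covectors with smaller support in `S`. -/
theorem indicator_mem_of_zeros_eq (O : OrientedMatroid α) {S : Set α} {X : α → SignType}
    (hX : X ∈ O.covectors)
    (ih : ∀ Z ∈ O.covectors, {f ∈ S | Z f ≠ 0} ⊂ {f ∈ S | X f ≠ 0} →
      S.indicator Z ∈ O.covectors) {Y : α → SignType} (hY : Y ∈ O.covectors)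
    (hYS : ∀ f ∉ S, Y f = 0) (hYX : ∀ f ∈ S, Y f = 0 ↔ X f = 0) :
    S.indicator X ∈ O.covectors := by
  classical
  induction hn : (signSep X Y).ncard using Nat.strong_induction_on generalizing Y with
  | _ n ihn =>
  have hsepS : ∀ W : α → SignType, (∀ f ∉ S, W f = 0) → signSep X W ⊆ S := by
    intro W hW f hf
    by_contra hfS
    exact hf.1 (by rw [hf.2, hW f hfS]; rfl)
  have hfin : (signSep X Y).Finite := O.finite_E.subset fun f hf => O.support_subset X hX f hf.1
  obtain hemp | ⟨e, he⟩ := (signSep X Y).eq_empty_or_nonempty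
  · have hXY : S.indicator X = Y := by
      funext f
      by_cases hf : f ∈ S
      · rw [Set.indicator_of_mem hf]
        have h1 : f ∉ signSep X Y := by simp [hemp]
        have h2 := hYX f hf
        have key : ∀ a b : SignType, (b = 0 ↔ a = 0) → ¬ (a ≠ 0 ∧ a = -b) → a = b := by decide
        exact key _ _ h2 h1
      · rw [Set.indicator_of_notMem hf, hYS f hf]
    rw [hXY]
    exact hY
  · have heS := hsepS Y hYS he
    -- On S, Z equals X off the separation set and vanishes at e, so `ih` applies to it. Replace Y
    -- by (Z on S) ∘ (-Y): it has the same zeros, agrees with X on S off the old separation set, and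
    -- at e equals -Y e = X e. The separation set shrinks.
    obtain ⟨Z, hZ, hZe, hZf⟩ := O.elim X hX Y hY e he
    have hZX : ∀ f ∈ S, f ∉ signSep X Y → Z f = X f := by
      intro f hf hfs
      rw [hZf f hfs]
      unfold signComp
      split_ifs with h
      · rw [h, (hYX f hf).2 h]
      · rfl
    have hZ0 : ∀ f ∈ S, X f = 0 → Z f = 0 := fun f hf h =>
      (hZX f hf (fun hs => hs.1 h)).trans h
    have hZS := ih Z hZ ⟨fun f hf => ⟨hf.1, fun h => hf.2 (hZ0 f hf.1 h)⟩,
      fun h => (h ⟨heS, he.1⟩ : e ∈ {f ∈ S | Z f ≠ 0}).2 hZe⟩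
    have hW := O.comp_mem _ hZS _ (O.neg_mem Y hY)
    have hWS : ∀ f ∉ S, signComp (S.indicator Z) (fun e => -Y e) f = 0 := fun f hf => by
      simp [signComp, hf, hYS f hf]
    have hneg : ∀ a : SignType, a ≠ 0 → a ≠ -a := by decide
    refine ihn _ ?_ hW hWS ?_ rfl
    · rw [← hn]
      refine Set.ncard_lt_ncard ⟨fun f hf => ?_, fun h => ?_⟩ hfin
      · by_contra hfs
        have hfS := hsepS _ hWS hf
        have := hf.2
        simp only [signComp, Set.indicator_of_mem hfS, hZX f hfS hfs, if_neg hf.1] at this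
        exact hneg _ hf.1 this
      · have := (h he).2
        simp only [signComp, Set.indicator_of_mem heS, hZe, if_true, neg_neg] at this
        exact hneg _ he.1 (he.2.trans (congrArg _ this.symm))
    · intro f hf
      by_cases h : X f = 0
      · simp [signComp, hf, hZ0 f hf h, (hYX f hf).2 h, h]
      · have hYf : Y f ≠ 0 := fun h' => h ((hYX f hf).1 h')
        have hnegne : ∀ a : SignType, a ≠ 0 → -a ≠ 0 := by decide
        simp only [h, iff_false, signComp, Set.indicator_of_mem hf]
        split_ifs with hz
        · exact hnegne _ hYf
        · exact hz

/-- The part of a covector in a separator of the underlying matroid is a covector. -/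
theorem indicator_mem_of_separator (O : OrientedMatroid α) {S : Set α} (hSE : S ⊆ O.E)
    (hS : ∀ C, O.toMatroid.IsCircuit C → C ⊆ S ∨ Disjoint C S) {X : α → SignType}
    (hX : X ∈ O.covectors) : S.indicator X ∈ O.covectors := by
  induction hn : {f ∈ S | X f ≠ 0}.ncard using Nat.strong_induction_on generalizing X with
  | _ n ihn =>
  have hfin : {f ∈ S | X f ≠ 0}.Finite := O.finite_E.subset fun f hf => hSE hf.1
  have hAE : (O.E \ S) ∪ {f ∈ S | X f = 0} ⊆ O.E :=
    Set.union_subset Set.sdiff_subset fun f hf => hSE hf.1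
  -- Otherwise x closes a circuit with the prescribed zeros. That circuit meets S, hence lies in S,
  -- and puts x in the closure of the zeros of X in S, which X itself rules out.
  have hex : ∀ x ∈ {f ∈ S | X f ≠ 0}, ∃ Y ∈ O.covectors, Y x ≠ 0 ∧
      ∀ f ∈ (O.E \ S) ∪ {f ∈ S | X f = 0}, Y f = 0 := by
    rintro x ⟨hxS, hxX⟩
    rw [← O.notMem_closure_iff hAE (hSE hxS)]
    intro hcl
    obtain ⟨C, hCA, hC, hxC⟩ := Matroid.exists_isCircuit_of_mem_closure hcl
      (by rintro (h | h); exacts [h.2 hxS, hxX h.2])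
    have hCS : C ⊆ S := (hS C hC).resolve_right fun h => Set.disjoint_left.1 h hxC hxS
    have hZE : {f ∈ S | X f = 0} ⊆ O.E := fun f hf => hSE hf.1
    refine (O.notMem_closure_iff hZE (hSE hxS)).2 ⟨X, hX, hxX, fun f hf => hf.2⟩ ?_
    rw [Matroid.mem_closure_iff_exists_isCircuit (fun h => hxX h.2)]
    refine ⟨C, fun f hf => ?_, hC, hxC⟩
    rcases hCA hf with rfl | h | h
    · exact Set.mem_insert _ _
    · exact absurd (hCS hf) h.2
    · exact Set.mem_insert_of_mem _ h
  obtain ⟨Y, hY, hYne, hY0⟩ := O.exists_covector_ne_zero_on hfin hex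
  refine O.indicator_mem_of_zeros_eq hX (fun Z hZ hlt => ?_) hY (fun f hf => ?_) (fun f hf => ?_)
  · exact ihn _ (hn ▸ Set.ncard_lt_ncard hlt hfin) hZ rfl
  · by_contra hne
    exact hne (hY0 f (Or.inl ⟨O.support_subset Y hY f hne, hf⟩))
  · exact ⟨fun h => by_contra fun h' => hYne f ⟨hf, h'⟩ h, fun h => hY0 f (Or.inr ⟨hf, h⟩)⟩

theorem indicator_sUnion_mem (O : OrientedMatroid α) {X : α → SignType} {𝒯 : Set (Set α)}
    (hfin : 𝒯.Finite) (h : ∀ T ∈ 𝒯, T.indicator X ∈ O.covectors) :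
    (⋃₀ 𝒯).indicator X ∈ O.covectors := by
  induction 𝒯, hfin using Set.Finite.induction_on with
  | empty =>
    rw [Set.sUnion_empty, Set.indicator_empty]
    exact O.zero_mem
  | @insert T 𝒯 _ _ ih =>
    have h1 := h T (Set.mem_insert _ _)
    have h2 := ih fun U hU => h U (Set.mem_insert_of_mem _ hU)
    -- Both parts come from the same X, so they agree on overlaps and compose to its part on the
    -- union.
    convert O.comp_mem _ h1 _ h2 using 1
    funext f
    rw [Set.sUnion_insert]
    by_cases hT : f ∈ T <;> by_cases hU : f ∈ ⋃₀ 𝒯 <;> by_cases hX : X f = 0 <;>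
      simp only [signComp, Set.indicator, Set.mem_union, hT, hU, hX, or_true, or_false, if_true,
        if_false]

theorem mem_restrict_covectors (O : OrientedMatroid α) {S : Set α} {X : α → SignType} :
    X ∈ (O.restrict S).covectors ↔ ∃ Y ∈ O.covectors, X = S.indicator Y := by
  classical
  simp only [restrict, Set.mem_ofPred_eq]
  refine exists_congr fun Y => and_congr_right fun _ => ?_
  have : S.indicator Y = fun e => if e ∈ S then Y e else 0 := by
    funext e; simp [Set.indicator_apply]
  rw [this]

end OrientedMatroid

/-! ### Reconstruction of a matroid from its connected components. -/

namespace Matroid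

variable {α : Type*} {M : Matroid α}

theorem mem_componentSet {S : Set α} : S ∈ M.componentSet ↔
    Minimal (fun S : Set α => S.Nonempty ∧ S ⊆ M.E ∧
      ∀ C, M.IsCircuit C → C ⊆ S ∨ Disjoint C S) S :=
  Iff.rfl

theorem subset_ground_of_mem_componentSet {S : Set α} (hS : S ∈ M.componentSet) : S ⊆ M.E :=
  (mem_componentSet.1 hS).prop.2.1

theorem finite_componentSet (hM : M.E.Finite) : M.componentSet.Finite :=
  hM.finite_subsets.subset fun _ hS => subset_ground_of_mem_componentSet hS

theorem exists_mem_componentSet (hM : M.E.Finite) {e : α} (he : e ∈ M.E) :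
    ∃ S ∈ M.componentSet, e ∈ S := by
  have hfin : {S | e ∈ S ∧ S ⊆ M.E ∧ ∀ C, M.IsCircuit C → C ⊆ S ∨ Disjoint C S}.Finite :=
    hM.finite_subsets.subset fun S hS => hS.2.1
  obtain ⟨S, hS⟩ := hfin.exists_minimal
    ⟨M.E, he, subset_rfl, fun C hC => Or.inl hC.subset_ground⟩
  obtain ⟨heS, hSE, hsep⟩ := hS.prop
  refine ⟨S, ⟨⟨⟨e, heS⟩, hSE, hsep⟩, ?_⟩, heS⟩
  rintro T ⟨⟨t, ht⟩, hTE, hTsep⟩ hTS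
  -- A smaller separator T missing e would make S ∖ T a separator containing e, against the
  -- minimality of S among those.
  by_cases heT : e ∈ T
  · exact hS.le_of_le ⟨heT, hTE, hTsep⟩ hTS
  · have hle := hS.le_of_le (y := S \ T)
      ⟨⟨heS, heT⟩, Set.sdiff_subset.trans hSE, fun C hC => ?_⟩ Set.sdiff_subset
    · exact absurd ht (hle (hTS ht)).2
    · rcases hsep C hC with h | h
      · rcases hTsep C hC with h' | h'
        · exact Or.inr (Set.disjoint_left.2 fun x hx hx' => hx'.2 (h' hx))
        · exact Or.inl fun x hx => ⟨h hx, Set.disjoint_left.1 h' hx⟩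
      · exact Or.inr (h.mono_right Set.sdiff_subset)

theorem sUnion_componentSet (hM : M.E.Finite) : ⋃₀ M.componentSet = M.E :=
  (Set.sUnion_subset fun _ hS => subset_ground_of_mem_componentSet hS).antisymm
    fun _ he => Set.mem_sUnion.2 (exists_mem_componentSet hM he)

theorem IsCircuit.exists_subset_component (hM : M.E.Finite) {C : Set α} (hC : M.IsCircuit C) :
    ∃ S ∈ M.componentSet, C ⊆ S := by
  obtain ⟨e, he⟩ := hC.nonempty
  obtain ⟨S, hS, heS⟩ := exists_mem_componentSet hM (hC.subset_ground he)
  exact ⟨S, hS, ((mem_componentSet.1 hS).prop.2.2 C hC).resolve_right fun h => Set.disjoint_left.1 h he heS⟩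

/-- A finite matroid is determined by its connected components. -/
theorem eq_of_restrict_component_eq {M' : Matroid α} (hM : M.E.Finite) (hM' : M'.E.Finite)
    (hc : M.componentSet = M'.componentSet)
    (h : ∀ S ∈ M.componentSet, M.restrict S = M'.restrict S) : M = M' := by
  have hE : M.E = M'.E := by rw [← sUnion_componentSet hM, ← sUnion_componentSet hM', hc]
  have key : ∀ C S, S ∈ M.componentSet → C ⊆ S → (M.IsCircuit C ↔ M'.IsCircuit C) := by
    intro C S hS hCS
    have hS1 := subset_ground_of_mem_componentSet hS
    have h1 := restrict_isCircuit_iff (C := C) hS1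
    have h2 := restrict_isCircuit_iff (C := C) (M := M') (hE ▸ hS1)
    rw [← h S hS, h1] at h2
    simpa [hCS] using h2
  refine ext_isCircuit hE fun C _ => ⟨fun hC => ?_, fun hC => ?_⟩
  · obtain ⟨S, hS, hCS⟩ := hC.exists_subset_component hM
    exact (key C S hS hCS).1 hC
  · obtain ⟨S, hS, hCS⟩ := hC.exists_subset_component hM'
    exact (key C S (hc ▸ hS) hCS).2 hC

end Matroid

/-- An oriented matroid is determined by its connected components. -/
theorem OrientedMatroid.eq_of_restrict_component_eq {α : Type*} {O O' : OrientedMatroid α}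
    (hc : O.toMatroid.componentSet = O'.toMatroid.componentSet)
    (h : ∀ S ∈ O.toMatroid.componentSet, O.restrict S = O'.restrict S) : O = O' := by
  have key : ∀ O O' : OrientedMatroid α,
      O.toMatroid.componentSet = O'.toMatroid.componentSet →
      (∀ S ∈ O.toMatroid.componentSet, O.restrict S = O'.restrict S) →
      O.covectors ⊆ O'.covectors := by
    intro O O' hc h X hX
    have hfin : O.toMatroid.E.Finite := O.finite_E
    have hX' : (⋃₀ O.toMatroid.componentSet).indicator X = X := by
      rw [Matroid.sUnion_componentSet hfin, Set.indicator_eq_self]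
      exact fun e he => O.support_subset X hX e he
    rw [← hX']
    refine O'.indicator_sUnion_mem (Matroid.finite_componentSet hfin) fun S hS => ?_
    -- The part of X on S is the part on S of some covector Y of O', and S is a separator of O'.
    have hmem : S.indicator X ∈ (O.restrict S).covectors :=
      O.mem_restrict_covectors.2 ⟨X, hX, rfl⟩
    rw [h S hS, O'.mem_restrict_covectors] at hmem
    obtain ⟨Y, hY, hYX⟩ := hmem
    rw [hYX]
    rw [hc] at hS
    have hS' := (Matroid.mem_componentSet.1 hS).prop
    exact O'.indicator_mem_of_separator hS'.2.1 hS'.2.2 hY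
  have hE : O.toMatroid.E = O'.toMatroid.E := by
    rw [← Matroid.sUnion_componentSet O.finite_E, ← Matroid.sUnion_componentSet O'.finite_E, hc]
  exact OrientedMatroid.ext hE ((key O O' hc h).antisymm
    (key O' O hc.symm fun S hS => (h S (hc ▸ hS)).symm))

/-! ### Recovering a port minor from its monomial. -/

namespace AnyMatroid

variable {α : Type*}

theorem ground_restrict (Q : AnyMatroid α) {S : Set α} (hS : S ⊆ Q.underlying.E) :
    (Q.restrict S).underlying.E = S := by
  cases Q with
  | unoriented M => rfl
  | oriented O => exact Set.inter_eq_right.2 hS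

theorem bracket_eq_monomial (K : Type*) [CommRing K] (Q : AnyMatroid α)
    (hQ : Q.underlying.E.Finite) :
    Q.bracket K = MvPolynomial.monomial
      (∑ S ∈ (Matroid.finite_componentSet hQ).toFinset, Finsupp.single (Q.restrict S) 1) 1 := by
  rw [bracket, finprod_mem_eq_finite_toFinset_prod _ (Matroid.finite_componentSet hQ),
    MvPolynomial.monomial_sum_one]
  rfl

theorem exists_component_of_bracket_eq {K : Type*} [CommRing K] [Nontrivial K]
    {Q Q' : AnyMatroid α} (hQ : Q.underlying.E.Finite) (hQ' : Q'.underlying.E.Finite)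
    (h : Q.bracket K = Q'.bracket K) {S : Set α} (hS : S ∈ Q.underlying.componentSet) :
    S ∈ Q'.underlying.componentSet ∧ Q.restrict S = Q'.restrict S := by
  classical
  rw [bracket_eq_monomial K Q hQ, bracket_eq_monomial K Q' hQ'] at h
  have h1 := DFunLike.congr_fun (MvPolynomial.monomial_left_injective one_ne_zero h) (Q.restrict S)
  have h2 : ∃ S' ∈ Q'.underlying.componentSet, Q'.restrict S' = Q.restrict S := by
    by_contra! hne
    rw [Finsupp.finsetSum_apply, Finsupp.finsetSum_apply,
      Finset.sum_eq_zero (s := (Matroid.finite_componentSet hQ').toFinset) fun S' hS' =>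
        Finsupp.single_eq_of_ne' (hne S' (by simpa using hS')), Finset.sum_eq_zero_iff] at h1
    simpa using h1 S (by simpa using hS)
  obtain ⟨S', hS', heq⟩ := h2
  -- A variable remembers the ground set of its matroid, so equal variables come from the same
  -- component.
  have hSS' : S' = S := by
    rw [← ground_restrict Q' (Matroid.subset_ground_of_mem_componentSet hS'), heq,
      ground_restrict Q (Matroid.subset_ground_of_mem_componentSet hS)]
  subst hSS'
  exact ⟨hS', heq.symm⟩

theorem componentSet_eq_of_bracket_eq {K : Type*} [CommRing K] [Nontrivial K]
    {Q Q' : AnyMatroid α} (hQ : Q.underlying.E.Finite) (hQ' : Q'.underlying.E.Finite)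
    (h : Q.bracket K = Q'.bracket K) : Q.underlying.componentSet = Q'.underlying.componentSet :=
  Set.Subset.antisymm (fun _ hS => (exists_component_of_bracket_eq hQ hQ' h hS).1)
    fun _ hS => (exists_component_of_bracket_eq hQ' hQ h.symm hS).1

theorem finite_ground_portMinor (N : AnyMatroid α) (A P : Finset α) :
    (N.portMinor A P).underlying.E.Finite := by
  cases N with
  | unoriented M => exact P.finite_toSet
  | oriented O => exact P.finite_toSet.subset Set.inter_subset_right

/-- The minors `N / A | P` are determined by their monomials. -/
theorem portMinor_eq_of_bracket_eq {K : Type*} [CommRing K] [Nontrivial K] (N : AnyMatroid α)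
    {A A' P : Finset α} (h : (N.portMinor A P).bracket K = (N.portMinor A' P).bracket K) :
    N.portMinor A P = N.portMinor A' P := by
  have hf := N.finite_ground_portMinor A P
  have hf' := N.finite_ground_portMinor A' P
  have hc := componentSet_eq_of_bracket_eq hf hf' h
  have hr := fun S hS => (exists_component_of_bracket_eq (S := S) hf hf' h hS).2
  cases N with
  | unoriented M =>
    exact congrArg unoriented (Matroid.eq_of_restrict_component_eq hf hf' hc
      fun S hS => unoriented.inj (hr S hS))
  | oriented O =>
    exact congrArg oriented (OrientedMatroid.eq_of_restrict_component_eq hc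
      fun S hS => oriented.inj (hr S hS))

/-! ### Closure in E and its effect on rank and minors. -/

theorem mem_flats {N : AnyMatroid α} {E F : Finset α} (hE : (E : Set α) ⊆ N.underlying.E) :
    F ∈ N.flats E ↔ F ⊆ E ∧ ∀ e ∈ E, e ∈ N.underlying.closure (F : Set α) → e ∈ F := by
  classical
  rw [flats, Finset.mem_filter, Finset.mem_powerset]
  refine and_congr_right fun hFE => ?_
  have hFE' : (F : Set α) ⊆ E := by exact_mod_cast hFE
  rw [Matroid.isFlat_iff_closure_eq, Matroid.restrict_closure_eq _ hFE' hE]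
  constructor
  · intro h e he hcl
    have : e ∈ (F : Set α) := h ▸ ⟨hcl, he⟩
    exact this
  · intro h
    exact Set.Subset.antisymm (fun e he => h e he.2 he.1)
      fun e he => ⟨Matroid.mem_closure_of_mem _ he (hFE'.trans hE), hFE' he⟩

open Classical in
/-- The closure of `A` in `N | E`. -/
noncomputable def flatClosure (N : AnyMatroid α) (E : Finset α)
    (hE : (E : Set α) ⊆ N.underlying.E) (A : Finset α) : N.flats E :=
  ⟨{e ∈ E | e ∈ N.underlying.closure (A : Set α)}, (mem_flats hE).2 ⟨Finset.filter_subset _ _,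
    fun _ he hcl => Finset.mem_filter.2 ⟨he,
      N.underlying.closure_subset_closure_of_subset_closure
        (fun _ hx => (Finset.mem_filter.1 hx).2) hcl⟩⟩⟩

section flatClosure

variable {N : AnyMatroid α} {E A : Finset α} (hE : (E : Set α) ⊆ N.underlying.E)

theorem mem_flatClosure {e : α} :
    e ∈ (N.flatClosure E hE A).1 ↔ e ∈ E ∧ e ∈ N.underlying.closure (A : Set α) := by
  classical exact Finset.mem_filter

theorem subset_flatClosure (hA : A ⊆ E) : A ⊆ (N.flatClosure E hE A).1 := fun _ he =>
  (mem_flatClosure hE).2 ⟨hA he,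
    N.underlying.mem_closure_of_mem he fun _ hx => hE (Finset.mem_coe.2 (hA hx))⟩

/-- This adjunction splits the subsets of a flat G by their closures, the flats below G. -/
theorem flatClosure_le_iff (hA : A ⊆ E) (G : N.flats E) :
    N.flatClosure E hE A ≤ G ↔ A ⊆ G.1 := by
  constructor
  · exact fun h => (subset_flatClosure hE hA).trans h
  · intro h e he
    obtain ⟨heE, hcl⟩ := (mem_flatClosure hE).1 he
    exact ((mem_flats hE).1 G.2).2 e heE
      (N.underlying.closure_subset_closure (by exact_mod_cast h) hcl)

theorem rk_flatClosure (hA : A ⊆ E) : N.rk (N.flatClosure E hE A).1 = N.rk A := by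
  refine congrArg ENat.toNat (le_antisymm ?_ ?_)
  · rw [← N.underlying.eRk_closure_eq (A : Set α)]
    exact N.underlying.eRk_mono fun e he => ((mem_flatClosure hE).1 he).2
  · exact N.underlying.eRk_mono (by exact_mod_cast subset_flatClosure hE hA)

/-- A basis of A is a basis of its closure, and it decides independence in the contraction. With
orientations, a covector vanishing on A vanishes on the closure. -/
theorem portMinor_flatClosure {P : Finset α} (hPE : Disjoint P E) (hA : A ⊆ E) :
    N.portMinor (N.flatClosure E hE A).1 P = N.portMinor A P := by
  have hsub := subset_flatClosure hE hA
  have hFE : (N.flatClosure E hE A).1 ⊆ E := fun e he => ((mem_flatClosure hE).1 he).1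
  have hcl : ∀ e ∈ (N.flatClosure E hE A).1, e ∈ N.underlying.closure (A : Set α) :=
    fun e he => ((mem_flatClosure hE).1 he).2
  generalize (N.flatClosure E hE A).1 = F at hsub hFE hcl
  have hPF : Disjoint P F := hPE.mono_right hFE
  have hPA : Disjoint P A := hPE.mono_right hA
  have hA' : (A : Set α) ⊆ N.underlying.E := fun e he => hE (hA he)
  cases N with
  | unoriented M =>
    refine congrArg unoriented (Matroid.ext_indep rfl fun I hI => ?_)
    obtain ⟨J, hJ⟩ := M.exists_isBasis (A : Set α) hA'
    have hJF : M.IsBasis J (F : Set α) := hJ.indep.isBasis_of_subset_of_subset_closure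
      (hJ.subset.trans (by exact_mod_cast hsub))
      (fun e he => by rw [hJ.closure_eq_closure]; exact hcl e he)
    have hIP : I ⊆ (P : Set α) := hI
    have h1 : Disjoint (A : Set α) I :=
      (Finset.disjoint_coe.2 hPA).symm.mono_right hIP
    have h2 : Disjoint (F : Set α) I :=
      (Finset.disjoint_coe.2 hPF).symm.mono_right hIP
    rw [Matroid.restrict_indep_iff, Matroid.restrict_indep_iff, hJ.contract_indep_iff,
      hJF.contract_indep_iff]
    simp only [h1, h2]
  | oriented O =>
    have hcov : (O.contract (F : Set α)).covectors = (O.contract (A : Set α)).covectors := by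
      refine Set.Subset.antisymm (fun X hX => ⟨hX.1, fun e he => hX.2 e (hsub he)⟩)
        fun X hX => ⟨hX.1, fun e he => ?_⟩
      by_contra hne
      exact (O.notMem_closure_iff hA' (O.support_subset X hX.1 e hne)).2
        ⟨X, hX.1, hne, hX.2⟩ (hcl e he)
    refine congrArg oriented (OrientedMatroid.ext ?_ ?_)
    · ext e
      have h1 : e ∈ P → e ∉ A := fun h => Finset.disjoint_left.1 hPA h
      have h2 : e ∈ P → e ∉ F := fun h => Finset.disjoint_left.1 hPF h
      change (e ∈ O.E ∧ e ∉ F) ∧ e ∈ P ↔ (e ∈ O.E ∧ e ∉ A) ∧ e ∈ P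
      tauto
    · simp only [OrientedMatroid.restrict, hcov]

end flatClosure

/-! ### Möbius inversion over flats. -/

open Classical in
theorem flatMu_inversion {K : Type*} [CommRing K] (N : AnyMatroid α) (E : Finset α)
    (f g : N.flats E → K) (h : ∀ F, g F = ∑ G : N.flats E with G ≤ F, f G) (F : N.flats E) :
    f F = ∑ G : N.flats E with G ≤ F, (N.flatMu E G F : K) * g G := by
  -- The same structure as in the definition of `flatMu`, so that the closing `rfl` of `hmu` holds.
  let : LocallyFiniteOrder (N.flats E) := Fintype.toLocallyFiniteOrder
  have hmu : ∀ H : N.flats E, H ≤ F →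
      ∑ G : N.flats E with H ≤ G ∧ G ≤ F, (N.flatMu E G F : K) = if H = F then 1 else 0 := by
    intro H hH
    have := congrArg (Int.cast : ℤ → K) (IncidenceAlgebra.sum_Icc_mu_left (𝕜 := ℤ) H F)
    push_cast at this
    rw [← this]
    refine Finset.sum_congr (by ext; simp) fun G _ => ?_
    rfl
  have h1 : ∑ G : N.flats E with G ≤ F, (N.flatMu E G F : K) * g G =
      ∑ H : N.flats E with H ≤ F,
        (∑ G : N.flats E with H ≤ G ∧ G ≤ F, (N.flatMu E G F : K)) * f H := by
    simp only [h, Finset.mul_sum, Finset.sum_mul]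
    refine Finset.sum_comm' fun G H => ?_
    simp only [Finset.mem_filter, Finset.mem_univ, true_and]
    exact ⟨fun h => ⟨⟨h.2, h.1⟩, h.2.trans h.1⟩, fun h => ⟨h.1.2, h.1.1⟩⟩
  rw [h1, Finset.sum_congr rfl fun H hH => by rw [hmu H (Finset.mem_filter.1 hH).2]]
  simp

open Classical in
-- Expanding the product over G chooses g e * v on A and r e on G ∖ A.
theorem sum_powerset_eq_prod {K : Type*} [CommRing K] {E G : Finset α} (hG : G ⊆ E) (r g : α → K)
    (v : K) :
    ∑ A ∈ G.powerset, (∏ e ∈ A, g e) * (∏ e ∈ E \ A, r e) * v ^ A.card =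
      (∏ e ∈ G, (r e + g e * v)) * ∏ e ∈ E \ G, r e := by
  rw [Finset.prod_congr rfl fun e _ => add_comm (r e) (g e * v), Finset.prod_add, Finset.sum_mul]
  refine Finset.sum_congr rfl fun A hA => ?_
  have hAG := Finset.mem_powerset.1 hA
  have hsplit : E \ A = (G \ A) ∪ (E \ G) := by
    ext e
    have := @hG e
    have := @hAG e
    simp only [Finset.mem_sdiff, Finset.mem_union]
    tauto
  rw [hsplit, Finset.prod_union (Finset.disjoint_left.2 fun e he he' =>
    (Finset.mem_sdiff.1 he').2 (Finset.mem_sdiff.1 he).1), Finset.prod_mul_distrib,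
    Finset.prod_const]
  ring

open Classical in
/-- The Möbius inversion formula for the sum over the sets with a given closure. -/
theorem sum_flatClosure_eq {K : Type*} [CommRing K] (N : AnyMatroid α) {E : Finset α}
    (hE : (E : Set α) ⊆ N.underlying.E) (r g : α → K) (v : K) (F : N.flats E) :
    ∑ A ∈ E.powerset with N.flatClosure E hE A = F,
        (∏ e ∈ A, g e) * (∏ e ∈ E \ A, r e) * v ^ A.card =
      ∑ G : N.flats E with G ≤ F, (N.flatMu E G F : K) *
        ((∏ e ∈ G.1, (r e + g e * v)) * ∏ e ∈ E \ G.1, r e) := by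
  refine N.flatMu_inversion E (fun F => ∑ A ∈ E.powerset with N.flatClosure E hE A = F,
    (∏ e ∈ A, g e) * (∏ e ∈ E \ A, r e) * v ^ A.card) _ (fun G => ?_) F
  have hGE : G.1 ⊆ E := ((mem_flats hE).1 G.2).1
  rw [← sum_powerset_eq_prod hGE]
  have hset : G.1.powerset = {A ∈ E.powerset | N.flatClosure E hE A ≤ G} := by
    ext A
    simp only [Finset.mem_powerset, Finset.mem_filter]
    exact ⟨fun h => ⟨h.trans hGE, (flatClosure_le_iff hE (h.trans hGE) G).2 h⟩,
      fun h => (flatClosure_le_iff hE h.1 G).1 h.2⟩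
  rw [hset, ← Finset.sum_fiberwise_of_maps_to (t := Finset.univ.filter (· ≤ G))
    (g := N.flatClosure E hE) (by intro A hA; simpa using (Finset.mem_filter.1 hA).2)]
  refine Finset.sum_congr rfl fun F hF => Finset.sum_congr ?_ fun _ _ => rfl
  ext A
  simp only [Finset.mem_filter] at hF ⊢
  exact ⟨fun h => ⟨h.1.1, h.2⟩, fun h => ⟨⟨h.1, h.2 ▸ hF.2⟩, h.2⟩⟩

/-! ### Collecting terms by closure, then by minor. -/

open Classical in
theorem corankNullity_eq_sum_flats {K : Type*} [CommRing K] (N : AnyMatroid α) {P E : Finset α}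
    (hPE : Disjoint P E) (hE : (E : Set α) ⊆ N.underlying.E) (r g : α → K) (u : K) (v : Kˣ) :
    N.corankNullity P E r g u (v : K) =
      ∑ F : N.flats E, (N.portMinor F.1 P).bracket K * MvPolynomial.C
        (u ^ (N.rank - (N.portMinor F.1 P).rank - N.rk F.1) * ((v⁻¹ : Kˣ) : K) ^ N.rk F.1 *
          ∑ G : N.flats E with G ≤ F, (N.flatMu E G F : K) *
            ((∏ e ∈ G.1, (r e + g e * (v : K))) * ∏ e ∈ E \ G.1, r e)) := by
  rw [corankNullity, ← Finset.sum_fiberwise E.powerset (N.flatClosure E hE)]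
  refine Finset.sum_congr rfl fun F _ => ?_
  rw [← N.sum_flatClosure_eq hE, Finset.mul_sum, map_sum, Finset.mul_sum]
  refine Finset.sum_congr rfl fun A hA => ?_
  obtain ⟨hAE, rfl⟩ := Finset.mem_filter.1 hA
  rw [Finset.mem_powerset] at hAE
  rw [portMinor_flatClosure hE hPE hAE, rk_flatClosure hE hAE]
  congr 2
  -- The subtraction is not truncated because ρA ≤ |A|; the extra factor v^ρA cancels against
  -- v^(-ρF).
  have hv : (v : K) ^ A.card = (v : K) ^ (A.card - N.rk A) * (v : K) ^ N.rk A := by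
    rw [← pow_add, Nat.sub_add_cancel (N.rk_le_card A)]
  have hinv : ((v⁻¹ : Kˣ) : K) ^ N.rk A * (v : K) ^ N.rk A = 1 := by
    rw [← mul_pow, Units.inv_mul, one_pow]
  rw [hv]
  linear_combination (-(u ^ (N.rank - (N.portMinor A P).rank - N.rk A) * (∏ e ∈ A, g e) *
    (∏ e ∈ E \ A, r e) * (v : K) ^ (A.card - N.rk A))) * hinv

end AnyMatroid

open Classical in
theorem mainTheorem12 {α K : Type*} [CommRing K] (N : AnyMatroid α) (P E : Finset α)
    (hPE : Disjoint P E) (hN : N.underlying.E = (P : Set α) ∪ (E : Set α))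
    (r g : α → K) (u : K) (v : Kˣ) :
    N.corankNullity P E r g u (v : K) =
      ∑ Q ∈ N.portMinors P E, Q.bracket K *
        MvPolynomial.C
          (∑ F : N.flats E with (N.portMinor F.1 P).bracket K = Q.bracket K,
            u ^ (N.rank - Q.rank - N.rk F.1) * ((v⁻¹ : Kˣ) : K) ^ N.rk F.1 *
              ∑ G : N.flats E with G ≤ F, (N.flatMu E G F : K) *
                ((∏ e ∈ G.1, (r e + g e * (v : K))) * ∏ e ∈ E \ G.1, r e)) := by
  -- Over the zero ring monomials do not distinguish minors, but both sides coincide trivially.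
  rcases subsingleton_or_nontrivial K with hK | hK
  · exact Subsingleton.elim _ _
  have hE : (E : Set α) ⊆ N.underlying.E := hN ▸ Set.subset_union_right
  rw [N.corankNullity_eq_sum_flats hPE hE, ← Finset.sum_fiberwise_of_maps_to
    (t := N.portMinors P E) (g := fun F : N.flats E => N.portMinor F.1 P)
    (fun F _ => Finset.mem_image_of_mem _
      (Finset.mem_powerset.2 ((AnyMatroid.mem_flats hE).1 F.2).1))]
  refine Finset.sum_congr rfl fun Q hQ => ?_
  obtain ⟨A, -, rfl⟩ := Finset.mem_image.1 hQ
  rw [map_sum, Finset.mul_sum]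
  -- Equality of monomials and equality of minors select the same flats.
  refine Finset.sum_congr (Finset.filter_congr fun F _ =>
    ⟨fun h => by rw [h], fun h => N.portMinor_eq_of_bracket_eq h⟩) fun F hF => ?_
  rw [N.portMinor_eq_of_bracket_eq (Finset.mem_filter.1 hF).2]
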